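/- A tree is a partially ordered set $T$ in which the set of strict predecessors of each point is well ordered; the height of a point is the order type of this set, and the height of $T$ is the least ordinal larger than the heights of all its points. A tree carries the interval topology, generated by the sets $(a,b]$ and $(-\infty,b]$ ($a,b\in T$), and is assumed to be Hausdorff: two points at limit levels with the same predecessors are equal. A space is $\omega_1$-compact if all its closed discrete subsets are at most countable, and locally metrizable if every point has a metrizable open neighborhood. A Suslin tree is a tree of height $\omega_1$ all of whose chains and antichains are at most countable. The road space $R_T$ of a tree $T$ is obtained from $T$ by joining each $x\in T$ to each of its immediate successors $y$ by an interval $[0,1]_x^y$, with $0$ glued to $x$ and $1$ glued to $y$; the order of $T$ is extended to $R_T$ in the obvious way. For $x\in T$ and $n\ge 1$ let $W_{x,n}$ consist of $x$ and of the portions $[0,1/n)_x^y$ for all immediate successors $y$ of $x$. The topology of $R_T$ has as a basis: the open subintervals of the intervals $(0,1)_x^y$; the sets $W_{x,n}$ for $x$ minimal in $T$; the sets $W_{x,n}\cup(1-1/n,1]_z^x$ for $x$ an immediate successor of $z$; and the sets $\{p\in R_T : z<p<x\}\cup\bigcup_{w\in T,\,z<w\le x}W_{w,n}$ for $x\in T$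 at a limit level and $z\in T$, $z<x$ (where $n\ge 1$). **Theorem.** Let $T$ be a Hausdorff tree. (1) Let $S\subset T$ be uncountable and $\omega_1$-compact in the subspace topology, and let $X$ be a locally metrizable Hausdorff space. Then there is no continuous $h:S\times[0,1]\to X$ such that $h(\cdot,0)$ is constant and $h(\cdot,1)$ has uncountable image. In particular, if $X$ contains a homeomorphic copy of $S$, then $X$ is not contractible. (2) If $T$ has height $\omega_1$ and contains an uncountable subset which is $\omega_1$-compact in the subspace topology, then the road space $R_T$ is not contractible. In particular, the road space of a Suslin tree is not contractible. -/

import Mathlib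

open Set Topology
open scoped Ordinal

universe u v

/-- A (set-theoretic) tree: a partial order in which the strict predecessors of each point are
well ordered. -/
class IsOrderTree (T : Type u) [PartialOrder T] : Prop where
  isWellOrder_Iio : ∀ x : T, IsWellOrder (Iio x) (fun a b => a < b)

/-- The order (interval) topology of a tree: it is generated by the sets `(a, b]` and `(-∞, b]`. -/
class IsTreeTopology (T : Type u) [PartialOrder T] [t : TopologicalSpace T] : Prop where
  topology_eq : t = TopologicalSpace.generateFrom
    ({U | ∃ a b : T, U = Ioc a b} ∪ {U | ∃ b : T, U = Iic b})

/-- Hausdorff trees: two points at limit levels with the same predecessors are equal. In a tree,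
a point is at a limit level iff it is neither minimal nor an immediate successor, which is
`Order.IsSuccLimit`. -/
class IsHausdorffTree (T : Type u) [PartialOrder T] : Prop where
  eq_of_Iio_eq : ∀ x y : T, Order.IsSuccLimit x → Order.IsSuccLimit y → Iio x = Iio y → x = y

/-- The height of a point: the order type of its set of strict predecessors. -/
noncomputable def pointHeight {T : Type u} [PartialOrder T] [IsOrderTree T] (x : T) : Ordinal.{u} :=
  haveI := IsOrderTree.isWellOrder_Iio x
  Ordinal.type (fun a b : Iio x => a < b)

/-- The height of a tree: the least ordinal above the heights of all its points. -/
noncomputable def treeHeight (T : Type u) [PartialOrder T] [IsOrderTree T] : Ordinal.{u} :=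
  ⨆ x : T, Order.succ (pointHeight x)

/-- A Suslin tree: height `ω₁`, and all chains and antichains are at most countable. -/
structure IsSuslinTree (T : Type u) [PartialOrder T] [IsOrderTree T] : Prop where
  height_eq : treeHeight T = ω₁
  countable_of_isChain : ∀ C : Set T, IsChain (· ≤ ·) C → C.Countable
  countable_of_isAntichain : ∀ A : Set T, IsAntichain (· ≤ ·) A → A.Countable

/-- `ω₁`-compact spaces: all closed discrete subsets are at most countable. -/
def OmegaOneCompact (Y : Type u) [TopologicalSpace Y] : Prop :=
  ∀ D : Set Y, IsClosed D → IsDiscrete D → D.Countable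

/-- Locally metrizable spaces: each point has a metrizable open neighborhood. -/
def LocallyMetrizable (X : Type u) [TopologicalSpace X] : Prop :=
  ∀ x : X, ∃ U : Set X, IsOpen U ∧ x ∈ U ∧ TopologicalSpace.MetrizableSpace U

/-- The points of the road space of `T`: the points of `T`, and, for each pair of consecutive points
`x ⋖ y` of `T`, the points of an open interval `(0, 1)` from `x` to `y`. -/
inductive RoadSpace (T : Type u) [PartialOrder T] : Type u
  | node (x : T) : RoadSpace T
  | edge (x y : T) (h : x ⋖ y) (t : Ioo (0 : ℝ) 1) : RoadSpace T

namespace RoadSpace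

variable {T : Type u} [PartialOrder T]

open Classical in
/-- The interval `[0, 1]` joining `x` to its immediate successor `y`, where `0` is glued to `x` and
`1` is glued to `y`. Only the values at `t ∈ [0, 1]` are used. -/
noncomputable def road {x y : T} (h : x ⋖ y) (t : ℝ) : RoadSpace T :=
  if ht : t ∈ Ioo (0 : ℝ) 1 then edge x y h ⟨t, ht⟩ else if t ≤ 0 then node x else node y

/-- The point `x` with the portion `[0, 1 / n)` of each interval emanating from `x`. -/
def star (x : T) (n : ℕ) : Set (RoadSpace T) :=
  {node x} ∪ ⋃ (y : T) (h : x ⋖ y), road h '' Ico 0 (1 / (n : ℝ))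

/-- The points of the road space strictly between the points `z` and `x` of `T`, for the order
extended from `T` to the road space. -/
def segment (z x : T) : Set (RoadSpace T) :=
  {p | match p with
    | node w => z < w ∧ w < x
    | edge a b _ _ => z ≤ a ∧ b ≤ x}

/-- The basic open sets of the road space. -/
inductive IsBasicOpen : Set (RoadSpace T) → Prop
  /-- open intervals inside a road -/
  | interval {x y : T} (h : x ⋖ y) (a b : ℝ) (ha : 0 ≤ a) (hb : b ≤ 1) :
      IsBasicOpen (road h '' Ioo a b)
  /-- basic neighborhoods of a minimal point -/
  | minimal (x : T) (hx : IsMin x) (n : ℕ) (hn : 1 ≤ n) :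
      IsBasicOpen (star x n)
  /-- basic neighborhoods of an immediate successor `x` of `z` -/
  | successor {z x : T} (h : z ⋖ x) (n : ℕ) (hn : 1 ≤ n) :
      IsBasicOpen (star x n ∪ road h '' Ioc (1 - 1 / (n : ℝ)) 1)
  /-- basic neighborhoods of a point at a limit level -/
  | limit {z x : T} (hx : Order.IsSuccLimit x) (h : z < x) (n : ℕ) (hn : 1 ≤ n) :
      IsBasicOpen (segment z x ∪ ⋃ w ∈ Ioc z x, star w n)

instance : TopologicalSpace (RoadSpace T) :=
  TopologicalSpace.generateFrom {U | IsBasicOpen U}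

end RoadSpace

/-! The engine is a pressing-down principle. Let `J` be a relation on intervals `[y, x]` that grows
with the interval and is absent from singletons and from small intervals strictly below any point. A
greedy selection along the order gives a closed discrete set, countable by `ω₁`-compactness, such
that every `x` lies above a selected point with no jump in between. Combining countably many such
relations (`exists_countable_jumpFree`) shows that, outside the down-closure of a countable set, no
jumps occur on cones. Hence countably many continuous maps into a space whose points are separated
by countably many locally void relations are constant on cones beyond a countable set.

For a homotopy `H` that is constant at time 0, suppose that the image at time 1 is uncountable.
Choose `x` whose cone has uncountable image and which lies beyond the countable set that decides
constancy of `H · r` on cones for all rational `r`. The times at which `H` is constant on the cone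
of `x` form a closed set containing 0. At any such time a higher cone stays in one separated open
set for a while, so constancy holds there at slightly later rational times and is pulled back to
`x`. The set therefore reaches 1, a contradiction (`countable_range_of_countable_image_Iic`). The
argument needs countable images of the sets `Iic k`, which follow by well-founded induction
(`countable_image_Iic`).

For road spaces it remains to see that `R_T` is Hausdorff, that it contains `T` injectively and
continuously, and that it is locally separated. The last needs only countable sets of predecessors,
hence the height `ω₁`. A Suslin tree is itself `ω₁`-compact. -/

/-- The properties of subspaces of Hausdorff trees that the argument uses: points below a given
point form a well-ordered chain, and neighborhoods are compatible with the order. -/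
class TreeLike (P : Type u) [PartialOrder P] [TopologicalSpace P] : Prop where
  wellFounded_lt : WellFounded (fun a b : P => a < b)
  le_or_le : ∀ x y z : P, x ≤ z → y ≤ z → x ≤ y ∨ y ≤ x
  Iic_mem_nhds : ∀ s : P, Iic s ∈ 𝓝 s
  Ioi_mem_nhds : ∀ y s : P, y < s → Ioi y ∈ 𝓝 s
  exists_upper : ∀ (s : P), ∀ N ∈ 𝓝 s, ∃ V ∈ 𝓝 s, V ⊆ N ∧ V ⊆ Iic s ∧
    ∀ y ∈ V, ∀ z, y ≤ z → z ≤ s → z ∈ V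
  isClosed_Iic : ∀ k : P, IsClosed (Iic k)

/-- A monotone predicate on intervals `[y, x]` which fails on singletons and on all small intervals
strictly below any given point. -/
structure IsJump {P : Type u} [PartialOrder P] [TopologicalSpace P] (J : P → P → Prop) : Prop where
  mono : ∀ y' y x x', y' ≤ y → y ≤ x → x ≤ x' → J y x → J y' x'
  irrefl : ∀ x, ¬ J x x
  locally_free : ∀ s, ∃ V ∈ 𝓝 s, ∀ y ∈ V, ∀ x ∈ V, y < x → x < s → ¬ J y x

/-- A space in which each point has an open neighborhood whose points are separated by countably
many locally void relations (a countable family of open covers). -/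
def LocallySeparated (X : Type v) [TopologicalSpace X] : Prop :=
  ∀ c : X, ∃ U : Set X, IsOpen U ∧ c ∈ U ∧ ∃ 𝒩 : Set (X → X → Prop), 𝒩.Countable ∧
    (∀ N ∈ 𝒩, ∀ p ∈ U, ∃ V ∈ 𝓝 p, ∀ a ∈ V, ∀ b ∈ V, ¬ N a b) ∧
    ∀ a ∈ U, ∀ b ∈ U, a ≠ b → ∃ N ∈ 𝒩, N a b

theorem LocallyMetrizable.locallySeparated {X : Type v} [TopologicalSpace X]
    (hX : LocallyMetrizable X) : LocallySeparated X := by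
  intro c
  obtain ⟨U, hU, hc, hm⟩ := hX c
  refine ⟨U, hU, hc, ?_⟩
  let _ := TopologicalSpace.metrizableSpaceMetric U
  refine ⟨range fun (n : ℕ) (a b : X) => ∃ (ha : a ∈ U) (hb : b ∈ U),
    1 / ((n : ℝ) + 1) ≤ dist (⟨a, ha⟩ : U) ⟨b, hb⟩, countable_range _, ?_, ?_⟩
  · rintro _ ⟨n, rfl⟩ p hp
    refine ⟨Subtype.val '' Metric.ball (⟨p, hp⟩ : U) (1 / ((n : ℝ) + 1) / 2), ?_, ?_⟩
    · exact hU.isOpenEmbedding_subtypeVal.isOpenMap.image_mem_nhds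
        (Metric.ball_mem_nhds (⟨p, hp⟩ : U) (half_pos Nat.one_div_pos_of_nat))
    · rintro _ ⟨a, ha, rfl⟩ _ ⟨b, hb, rfl⟩ ⟨h1, h2, h⟩
      rw [Metric.mem_ball] at ha hb
      have := dist_triangle_right a b ⟨p, hp⟩
      have h' : 1 / ((n : ℝ) + 1) ≤ dist a b := h
      linarith
  · intro a ha b hb hab
    have : 0 < dist (⟨a, ha⟩ : U) ⟨b, hb⟩ := dist_pos.2 (by simpa using hab)
    obtain ⟨n, hn⟩ := exists_nat_one_div_lt this
    exact ⟨_, ⟨n, rfl⟩, ha, hb, hn.le⟩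

/-! ### Jumps and countable sets in `ω₁`-compact tree-like spaces. -/

namespace TreeLike

variable {P : Type u} [PartialOrder P] [TopologicalSpace P] [TreeLike P]

theorem exists_minimal_le {p : P → Prop} {x : P} (hx : p x) :
    ∃ m, p m ∧ m ≤ x ∧ ∀ y, y < m → ¬ p y := by
  let A := {y | p y ∧ y ≤ x}
  have hA : A.Nonempty := ⟨x, hx, le_rfl⟩
  refine ⟨wellFounded_lt.min A hA, (wellFounded_lt.min_mem A hA).1,
    (wellFounded_lt.min_mem A hA).2, fun y hy hpy => ?_⟩
  exact wellFounded_lt.not_lt_min A (x := y)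
    ⟨hpy, hy.le.trans (wellFounded_lt.min_mem A hA).2⟩ hy

theorem isOpen_of_isLowerSet {A : Set P} (hA : IsLowerSet A) : IsOpen A := by
  rw [isOpen_iff_mem_nhds]
  intro x hx
  filter_upwards [Iic_mem_nhds x] with y hy using hA hy hx

theorem isClosed_Ici (x : P) : IsClosed (Ici x) := by
  rw [← isOpen_compl_iff]
  exact isOpen_of_isLowerSet (isUpperSet_Ici x).compl

/-- The hypothesis makes `Q` closed and discrete: once the at most one point of `Q` in `V` below `s`
is cut off, only `s` itself can remain. -/
theorem countable_of_locally_subsingleton (hP : OmegaOneCompact P) {Q : Set P}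
    (h : ∀ s, ∃ V ∈ 𝓝 s, ∀ a ∈ Q, a ∈ V → a < s → ∀ b ∈ Q, b ∈ V → b < s → a = b) :
    Q.Countable := by
  have key : IsClosed Q ∧ IsDiscrete Q := by
    rw [isClosed_and_discrete_iff]
    intro s
    obtain ⟨V, hV, hVQ⟩ := h s
    have : ∃ W ∈ 𝓝 s, ∀ a ∈ Q, a ∈ W → a = s := by
      by_cases hex : ∃ a ∈ Q, a ∈ V ∧ a < s
      · obtain ⟨a, haQ, haV, has⟩ := hex
        refine ⟨V ∩ Iic s ∩ Ioi a, Filter.inter_mem (Filter.inter_mem hV (Iic_mem_nhds s))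
          (Ioi_mem_nhds a s has), ?_⟩
        rintro b hb ⟨⟨hbV, hbs⟩, hab⟩
        by_contra hne
        have := hVQ a haQ haV has b hb hbV (lt_of_le_of_ne hbs hne)
        exact hab.ne this
      · push Not at hex
        refine ⟨V ∩ Iic s, Filter.inter_mem hV (Iic_mem_nhds s), ?_⟩
        rintro b hb ⟨hbV, hbs⟩
        by_contra hne
        exact hex b hb hbV (lt_of_le_of_ne hbs hne)
    obtain ⟨W, hW, hWQ⟩ := this
    rw [Filter.disjoint_principal_right, mem_nhdsWithin_iff_exists_mem_nhds_inter]
    refine ⟨W, hW, ?_⟩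
    rintro y ⟨hyW, hys⟩ hyQ
    exact hys (hWQ y hyQ hyW)
  exact hP Q key.1 key.2

theorem countable_of_isAntichain (hP : OmegaOneCompact P) {A : Set P}
    (hA : ∀ a ∈ A, ∀ b ∈ A, ¬ a < b) : A.Countable := by
  refine countable_of_locally_subsingleton hP fun s => ⟨univ, Filter.univ_mem, ?_⟩
  intro a ha _ has b hb _ hbs
  rcases le_or_le a b s has.le hbs.le with h | h
  · exact h.eq_of_not_lt (hA a ha b hb)
  · exact (h.eq_of_not_lt (hA b hb a ha)).symm

/-- Greedy selection: a point is selected when there is a jump to it from every selected point below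
it. Two selected points below `s` in a jump-free neighborhood would contradict this, so the
selection is countable. A rejected `x` has, by definition, a selected `q < x` without a jump. -/
theorem exists_countable_jumpFree_one (hP : OmegaOneCompact P) {J : P → P → Prop}
    (hJ : IsJump J) :
    ∃ Q : Set P, Q.Countable ∧ ∀ x, ∃ q ∈ Q, q ≤ x ∧ ¬ J q x := by
  let G : P → Prop := (wellFounded_lt (P := P)).fix
    (fun x ih => ∀ q (h : q < x), ih q h → J q x)
  have hG : ∀ x, G x ↔ ∀ q, q < x → G q → J q x := by
    intro x
    have := (wellFounded_lt (P := P)).fix_eq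
      (C := fun _ => Prop) (fun x ih => ∀ q (h : q < x), ih q h → J q x) x
    exact iff_of_eq this
  refine ⟨{x | G x}, ?_, ?_⟩
  · refine countable_of_locally_subsingleton hP fun s => ?_
    obtain ⟨V, hV, hVJ⟩ := hJ.locally_free s
    refine ⟨V, hV, ?_⟩
    intro a ha haV has b hb hbV hbs
    by_contra hne
    rcases le_or_le a b s has.le hbs.le with h | h
    · have hlt := lt_of_le_of_ne h hne
      exact hVJ a haV b hbV hlt hbs ((hG b).1 hb a hlt ha)
    · have hlt := lt_of_le_of_ne h (Ne.symm hne)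
      exact hVJ b hbV a haV hlt has ((hG a).1 ha b hlt hb)
  · intro x
    by_cases hx : G x
    · exact ⟨x, hx, le_rfl, hJ.irrefl x⟩
    · rw [hG] at hx
      push Not at hx
      obtain ⟨q, hq, hGq, hn⟩ := hx
      exact ⟨q, hGq, hq.le, hn⟩

/-- Points of `K` below no member of `Q` form an antichain. On the points of `K` below a fixed `q`,
sending `x` to the least member of `Q` in `(x, q]` is injective, because a member of `Q` separates
any two of them. -/
theorem countable_of_separated (hP : OmegaOneCompact P) {Q K : Set P} (hQ : Q.Countable)
    (hK : ∀ y ∈ K, ∀ x ∈ K, y < x → ∃ q ∈ Q, y < q ∧ q ≤ x) : K.Countable := by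
  have h1 : (K ∩ {x | ∀ q ∈ Q, ¬ x < q}).Countable := by
    refine countable_of_isAntichain hP ?_
    rintro a ⟨ha, ha'⟩ b ⟨hb, _⟩ hab
    obtain ⟨q, hq, h, _⟩ := hK a ha b hb hab
    exact ha' q hq h
  have h2 : ∀ q ∈ Q, (K ∩ Iio q).Countable := by
    intro q hq
    have : ∀ x ∈ K ∩ Iio q, ∃ m, (m ∈ Q ∧ x < m) ∧ m ≤ q ∧ ∀ y, y < m → ¬ (y ∈ Q ∧ x < y) :=
      fun x hx => exists_minimal_le (p := fun m => m ∈ Q ∧ x < m) ⟨hq, hx.2⟩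
    choose! g hg1 hg2 hg3 using this
    refine MapsTo.countable_of_injOn (f := g) (t := Q) (fun x hx => (hg1 x hx).1) ?_ hQ
    have aux : ∀ x ∈ K ∩ Iio q, ∀ x' ∈ K ∩ Iio q, x < x' → g x ≠ g x' := by
      intro x hx x' hx' hlt heq
      obtain ⟨r, hr, hxr, hrx⟩ := hK x hx.1 x' hx'.1 hlt
      refine hg3 x hx r ?_ ⟨hr, hxr⟩
      rw [heq]
      exact hrx.trans_lt (hg1 x' hx').2
    intro x hx x' hx' heq
    by_contra hne
    rcases le_or_le x x' q hx.2.le hx'.2.le with h | h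
    · exact aux x hx x' hx' (lt_of_le_of_ne h hne) heq
    · exact aux x' hx' x hx (lt_of_le_of_ne h (Ne.symm hne)) heq.symm
  refine (h1.union (hQ.biUnion h2)).mono ?_
  intro x hx
  by_cases h : ∀ q ∈ Q, ¬ x < q
  · exact Or.inl ⟨hx, h⟩
  · push Not at h
    obtain ⟨q, hq, hxq⟩ := h
    exact Or.inr (mem_biUnion hq ⟨hx, hxq⟩)

/-- The sets `Q i` serve one relation each. A common base point for `x` is the least `k ≤ x` with no
member of `⋃ i, Q i` in `(k, x]`: it lies above the base point of every `J i`, so monotonicity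
excludes all jumps. Such `k` are limits or members of the union, and are countably many by
`countable_of_separated`. -/
theorem exists_countable_jumpFree (hP : OmegaOneCompact P) {ι : Type*} [Countable ι]
    {J : ι → P → P → Prop} (hJ : ∀ i, IsJump (J i)) :
    ∃ K : Set P, K.Countable ∧ ∀ x, ∃ k ∈ K, k ≤ x ∧ ∀ i, ¬ J i k x := by
  choose Q hQ hQJ using fun i => exists_countable_jumpFree_one hP (hJ i)
  have hQc : (⋃ i, Q i).Countable := countable_iUnion hQ
  refine ⟨{x | ∀ y, y < x → ∃ q ∈ ⋃ i, Q i, y < q ∧ q ≤ x},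
    countable_of_separated hP hQc fun y _ x hx hyx => hx y hyx, fun x => ?_⟩
  obtain ⟨k, hk, hkx, hmin⟩ := exists_minimal_le
    (p := fun y => y ≤ x ∧ ∀ q ∈ ⋃ i, Q i, y < q → ¬ q ≤ x) (x := x)
    ⟨le_rfl, fun q _ h h' => (h.trans_le h').false⟩
  refine ⟨k, fun y hy => ?_, hkx, fun i hi => ?_⟩
  · have := hmin y hy
    push Not at this
    obtain ⟨q, hq, hyq, hqx⟩ := this (hy.le.trans hkx)
    refine ⟨q, hq, hyq, ?_⟩
    rcases le_or_le q k x hqx hkx with h | h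
    · exact h
    · rcases h.eq_or_lt with h | h
      · exact h.ge
      · exact absurd hqx (hk.2 q hq h)
  · obtain ⟨q, hq, hqx, hn⟩ := hQJ i x
    refine hn ((hJ i).mono _ _ _ _ ?_ hkx le_rfl hi)
    rcases le_or_le q k x hqx hkx with h | h
    · exact h
    · rcases h.eq_or_lt with h | h
      · exact h.ge
      · exact absurd hqx (hk.2 q (mem_iUnion.2 ⟨i, hq⟩) h)

/-- Beyond a countable set there are no jumps. -/
theorem exists_countable_cone_jumpFree (hP : OmegaOneCompact P) {ι : Type*} [Countable ι]
    {J : ι → P → P → Prop} (hJ : ∀ i, IsJump (J i)) :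
    ∃ K : Set P, K.Countable ∧ ∀ x, (∀ k ∈ K, ¬ x ≤ k) → ∀ y, x ≤ y → ∀ i, ¬ J i x y := by
  obtain ⟨K, hK, h⟩ := exists_countable_jumpFree hP hJ
  refine ⟨K, hK, fun x hx y hxy i hi => ?_⟩
  obtain ⟨k, hk, hky, hn⟩ := h y
  refine hn i ((hJ i).mono _ _ _ _ ?_ hxy le_rfl hi)
  exact (le_or_le k x y hky hxy).resolve_right (hx k hk)

/-- Along a chain `D` switches on at most once. The switch may occur exactly at `s`, with points
where `D` fails accumulating at `s`; this is why `IsJump` ignores intervals ending at `s`. -/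
theorem isJump_of_monotone {D : P → Prop} (hD : ∀ x y, x ≤ y → D x → D y) :
    IsJump fun y x => ¬ D y ∧ D x where
  mono y' y x x' h1 _ h3 h := ⟨fun h' => h.1 (hD _ _ h1 h'), hD _ _ h3 h.2⟩
  irrefl x h := h.1 h.2
  locally_free s := by
    by_cases h : ∃ y < s, D y
    · obtain ⟨y, hy, hDy⟩ := h
      exact ⟨Ioi y, Ioi_mem_nhds y s hy, fun a ha b _ _ _ hJ => hJ.1 (hD _ _ (le_of_lt ha) hDy)⟩
    · push Not at h
      exact ⟨univ, Filter.univ_mem, fun a _ b _ _ hbs hJ => h b hbs hJ.2⟩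

theorem exists_countable_cone_iff (hP : OmegaOneCompact P) {ι : Type*} [Countable ι]
    {D : ι → P → Prop} (hD : ∀ i x y, x ≤ y → D i x → D i y) :
    ∃ K : Set P, K.Countable ∧ ∀ x, (∀ k ∈ K, ¬ x ≤ k) → ∀ y, x ≤ y → ∀ i, D i y → D i x := by
  obtain ⟨K, hK, h⟩ := exists_countable_cone_jumpFree hP (fun i => isJump_of_monotone (hD i))
  refine ⟨K, hK, fun x hx y hxy i hy => ?_⟩
  by_contra hn
  exact h x hx y hxy i ⟨hn, hy⟩

/-! ### Maps and homotopies into locally separated spaces. -/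

section Separation

variable {X : Type v} [TopologicalSpace X]

/-- The relation that some pair of values of `f` on `[y, x] ∩ C` is related by `N`. -/
theorem isJump_of_continuous {C : Set P} (hC : IsClosed C) {f : P → X} (hf : Continuous f)
    {U : Set X} (hfU : ∀ x ∈ C, f x ∈ U) {N : X → X → Prop}
    (hN : ∀ p ∈ U, ∃ V ∈ 𝓝 p, ∀ a ∈ V, ∀ b ∈ V, ¬ N a b) :
    IsJump fun y x => ∃ a ∈ Icc y x ∩ C, ∃ b ∈ Icc y x ∩ C, N (f a) (f b) where
  mono := by
    rintro y' y x x' h1 _ h3 ⟨a, ha, b, hb, h⟩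
    exact ⟨a, ⟨Icc_subset_Icc h1 h3 ha.1, ha.2⟩, b, ⟨Icc_subset_Icc h1 h3 hb.1, hb.2⟩, h⟩
  irrefl := by
    rintro x ⟨a, ⟨ha, haC⟩, b, ⟨hb, -⟩, h⟩
    obtain rfl : a = x := le_antisymm ha.2 ha.1
    obtain rfl : b = a := le_antisymm hb.2 hb.1
    obtain ⟨V, hV, hVN⟩ := hN _ (hfU _ haC)
    exact hVN _ (mem_of_mem_nhds hV) _ (mem_of_mem_nhds hV) h
  locally_free := by
    intro s
    have : ∃ W ∈ 𝓝 s, ∀ a ∈ W ∩ C, ∀ b ∈ W ∩ C, ¬ N (f a) (f b) := by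
      by_cases hs : s ∈ C
      · obtain ⟨V, hV, hVN⟩ := hN _ (hfU _ hs)
        exact ⟨f ⁻¹' V, hf.continuousAt hV, fun a ha b hb => hVN _ ha.1 _ hb.1⟩
      · exact ⟨Cᶜ, hC.isOpen_compl.mem_nhds hs, fun a ha => absurd ha.2 ha.1⟩
    obtain ⟨W, hW, hWN⟩ := this
    obtain ⟨V, hV, hVW, hVs, hup⟩ := exists_upper s W hW
    refine ⟨V, hV, ?_⟩
    rintro y hy x hx _ _ ⟨a, ⟨ha, haC⟩, b, ⟨hb, hbC⟩, h⟩
    exact hWN a ⟨hVW (hup y hy a ha.1 (ha.2.trans (hVs hx))), haC⟩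
      b ⟨hVW (hup y hy b hb.1 (hb.2.trans (hVs hx))), hbC⟩ h

theorem isJump_prod {C : Set P} (hC : IsClosed C) {ι : Type*} {f : ι → P → X}
    (hf : ∀ i, Continuous (f i)) {U : Set X} (hfU : ∀ i, ∀ x ∈ C, f i x ∈ U)
    {𝒩 : Set (X → X → Prop)}
    (hN : ∀ N ∈ 𝒩, ∀ p ∈ U, ∃ V ∈ 𝓝 p, ∀ a ∈ V, ∀ b ∈ V, ¬ N a b) (j : ι × 𝒩) :
    IsJump fun y x => ∃ a ∈ Icc y x ∩ C, ∃ b ∈ Icc y x ∩ C, j.2.1 (f j.1 a) (f j.1 b) :=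
  isJump_of_continuous hC (hf j.1) (hfU j.1) (hN j.2.1 j.2.2)

theorem exists_countable_cone_eq (hP : OmegaOneCompact P) {ι : Type*} [Countable ι]
    {C : Set P} (hC : IsClosed C) {f : ι → P → X}
    (hf : ∀ i, Continuous (f i)) {U : Set X} (hfU : ∀ i, ∀ x ∈ C, f i x ∈ U)
    {𝒩 : Set (X → X → Prop)} (h𝒩 : 𝒩.Countable)
    (hN : ∀ N ∈ 𝒩, ∀ p ∈ U, ∃ V ∈ 𝓝 p, ∀ a ∈ V, ∀ b ∈ V, ¬ N a b)
    (hsep : ∀ a ∈ U, ∀ b ∈ U, a ≠ b → ∃ N ∈ 𝒩, N a b) :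
    ∃ K : Set P, K.Countable ∧ ∀ x ∈ C, (∀ k ∈ K, ¬ x ≤ k) → ∀ y ∈ C, x ≤ y →
      ∀ i, f i x = f i y := by
  have := h𝒩.to_subtype
  obtain ⟨K, hK, h⟩ := exists_countable_cone_jumpFree hP (isJump_prod hC hf hfU hN)
  refine ⟨K, hK, fun x hxC hx y hyC hxy i => ?_⟩
  by_contra hne
  obtain ⟨N, hN', hab⟩ := hsep _ (hfU i x hxC) _ (hfU i y hyC) hne
  exact h x hx y hxy ⟨i, N, hN'⟩ ⟨x, ⟨⟨le_rfl, hxy⟩, hxC⟩, y, ⟨⟨hxy, le_rfl⟩, hyC⟩, hab⟩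

/-- Assign to each point its jump-free base point in the countable set `K`. Two points of the chain
`[s, k]` with the same base point span no jump, so no relation in `𝒩` separates their images: `f` is
constant on each of countably many fibres. -/
theorem countable_image_Icc (hP : OmegaOneCompact P) {s k : P} {f : P → X} (hf : Continuous f)
    {U : Set X} (hfU : ∀ x ∈ Icc s k, f x ∈ U)
    {𝒩 : Set (X → X → Prop)} (h𝒩 : 𝒩.Countable)
    (hN : ∀ N ∈ 𝒩, ∀ p ∈ U, ∃ V ∈ 𝓝 p, ∀ a ∈ V, ∀ b ∈ V, ¬ N a b)
    (hsep : ∀ a ∈ U, ∀ b ∈ U, a ≠ b → ∃ N ∈ 𝒩, N a b) : (f '' Icc s k).Countable := by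
  have := h𝒩.to_subtype
  have hC : IsClosed (Icc s k) := (isClosed_Ici s).inter (isClosed_Iic k)
  obtain ⟨K, hK, h⟩ := exists_countable_jumpFree hP
    (isJump_prod (ι := Unit) hC (f := fun _ => f) (fun _ => hf) (fun _ => hfU) hN)
  choose g hgK hgx hg using h
  have key : ∀ a ∈ Icc s k, ∀ b ∈ Icc s k, a ≤ b → g a = g b → f a = f b := by
    intro a ha b hb hab he
    by_contra hne
    obtain ⟨N, hN', hr⟩ := hsep _ (hfU a ha) _ (hfU b hb) hne
    exact hg b ⟨(), N, hN'⟩ ⟨a, ⟨⟨he ▸ hgx a, hab⟩, ha⟩, b, ⟨⟨hgx b, le_rfl⟩, hb⟩, hr⟩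
  have : (f '' Icc s k) ⊆ ⋃ q ∈ K, f '' {a ∈ Icc s k | g a = q} := by
    rintro _ ⟨a, ha, rfl⟩
    exact mem_biUnion (hgK a) ⟨a, ⟨ha, rfl⟩, rfl⟩
  refine (hK.biUnion fun q _ => Set.Subsingleton.countable ?_).mono this
  rintro _ ⟨a, ⟨ha, haq⟩, rfl⟩ _ ⟨b, ⟨hb, hbq⟩, rfl⟩
  rcases le_or_le a b k ha.2 hb.2 with hab | hab
  · exact key a ha b hb hab (haq.trans hbq.symm)
  · exact (key b hb a ha hab (hbq.trans haq.symm)).symm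

/-- Beyond a countable set, intervals lie in one member of a given countable open cover. -/
theorem exists_countable_Icc_subset (hP : OmegaOneCompact P) {O : ℕ → Set P}
    (hO : ∀ n, IsOpen (O n)) {x : P} (hcov : ∀ y, x ≤ y → ∃ n, y ∈ O n) :
    ∃ K : Set P, K.Countable ∧ ∀ y, x ≤ y → (∀ k ∈ K, ¬ y ≤ k) →
      ∀ z, y ≤ z → ∃ n, Icc y z ⊆ O n := by
  -- Intersecting with `Ici x` makes the relation vanish off the cone of `x`, where the sets `O n`
  -- need not cover; there any index, such as 0, works.
  have hJ : IsJump fun y z : P => ∀ n, ¬ Icc y z ∩ Ici x ⊆ O n := by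
    refine ⟨?_, ?_, ?_⟩
    · intro y' y z z' h1 _ h3 h n hn
      exact h n ((inter_subset_inter_left _ (Icc_subset_Icc h1 h3)).trans hn)
    · intro y h
      by_cases hx : x ≤ y
      · obtain ⟨n, hn⟩ := hcov y hx
        exact h n (inter_subset_left.trans (by simpa using hn))
      · refine h 0 ?_
        rintro w ⟨hw, hxw⟩
        exact absurd (le_trans hxw hw.2) hx
    · intro s
      by_cases hx : x ≤ s
      · obtain ⟨n, hn⟩ := hcov s hx
        obtain ⟨V, hV, hVO, hVs, hup⟩ := exists_upper s _ ((hO n).mem_nhds hn)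
        refine ⟨V, hV, fun y hy z hz _ _ h => h n ?_⟩
        rintro w ⟨hw, -⟩
        exact hVO (hup y hy w hw.1 (hw.2.trans (hVs hz)))
      · refine ⟨Iic s, Iic_mem_nhds s, fun y _ z hz _ _ h => h 0 ?_⟩
        rintro w ⟨hw, hxw⟩
        exact absurd (le_trans hxw (hw.2.trans hz)) hx
  obtain ⟨K, hK, h⟩ := exists_countable_cone_jumpFree hP (ι := Unit) (fun _ => hJ)
  refine ⟨K, hK, fun y hxy hy z hyz => ?_⟩
  have := h y hy z hyz ()
  push Not at this
  obtain ⟨n, hn⟩ := this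
  exact ⟨n, fun w hw => hn ⟨hw, hxy.trans hw.1⟩⟩

/-- For each `n`, the failure of `[y, z] ⊆ O n` is monotone in `z`, so beyond a countable set it no
longer changes: an `n` that works for `z` works for everything above `z`. -/
theorem exists_countable_Ici_subset (hP : OmegaOneCompact P) {O : ℕ → Set P} {y : P}
    (hy : ∀ z, y ≤ z → ∃ n, Icc y z ⊆ O n) :
    ∃ K : Set P, K.Countable ∧ ∀ z, y ≤ z → (∀ k ∈ K, ¬ z ≤ k) → ∃ n, Ici z ⊆ O n := by
  obtain ⟨K, hK, h⟩ := exists_countable_cone_iff hP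
    (D := fun n z => ∃ w ∈ Icc y z, w ∉ O n)
    (fun n a b hab ⟨w, hw, hn⟩ => ⟨w, Icc_subset_Icc le_rfl hab hw, hn⟩)
  refine ⟨K, hK, fun z hyz hz => ?_⟩
  obtain ⟨n, hn⟩ := hy z hyz
  refine ⟨n, fun w hw => ?_⟩
  by_contra hwn
  obtain ⟨v, hv, hvn⟩ := h z hz w hw n ⟨w, ⟨hyz.trans hw, le_rfl⟩, hwn⟩
  exact hvn (hn hv)

variable [T2Space X]

theorem countable_range_of_countable_image_Iic (hP : OmegaOneCompact P)
    (hX : LocallySeparated X) {H : P → ℝ → X} (hH : Continuous fun p : P × ℝ => H p.1 p.2) {c : X}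
    (hc : ∀ p, H p 0 = c) (hI : ∀ k, ((fun p => H p 1) '' Iic k).Countable) :
    (range fun p => H p 1).Countable := by
  set f : P → X := fun p => H p 1 with hf
  have hHt : ∀ t, Continuous fun p => H p t := fun t => hH.comp (Continuous.prodMk_left t)
  have hHp : ∀ p, Continuous (H p) := fun p => hH.comp (Continuous.prodMk_right p)
  -- `A` collects the points whose cone has uncountable image. The rest contributes only countably
  -- many values, since its minimal elements form an antichain.
  let A : Set P := {x | ¬ (f '' Ici x).Countable}
  have hA : (f '' Aᶜ).Countable := by
    let M : Set P := {m | m ∉ A ∧ ∀ y, y < m → ¬ y ∉ A}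
    have hM : M.Countable := countable_of_isAntichain hP fun a ha b hb hab => hb.2 a hab ha.1
    refine (hM.biUnion (t := fun m _ => f '' Ici m) fun m hm => not_not.1 hm.1).mono ?_
    rintro _ ⟨x, hx, rfl⟩
    obtain ⟨m, h1, h2, h3⟩ := exists_minimal_le (p := fun y => y ∉ A) hx
    exact mem_biUnion (show m ∈ M from ⟨h1, h3⟩) ⟨x, h2, rfl⟩
  have hdown : ∀ K : Set P, K.Countable → (f '' {x | ∃ k ∈ K, x ≤ k}).Countable := by
    intro K hK
    refine (hK.biUnion (t := fun k _ => f '' Iic k) fun k _ => hI k).mono ?_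
    rintro _ ⟨x, ⟨k, hk, hxk⟩, rfl⟩
    exact mem_biUnion hk ⟨x, hxk, rfl⟩
  have hbig : ∀ B : Set P, ¬ (f '' B).Countable → ∀ K : Set P, K.Countable →
      ∃ z ∈ B, z ∈ A ∧ ∀ k ∈ K, ¬ z ≤ k := by
    intro B hB K hK
    by_contra! hcon
    refine hB ((hA.union (hdown K hK)).mono ?_)
    rintro _ ⟨z, hz, rfl⟩
    by_cases hzA : z ∈ A
    · exact Or.inr ⟨z, hcon z hz hzA, rfl⟩
    · exact Or.inl ⟨z, hzA, rfl⟩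
  by_contra hunc
  -- Constancy of `H · r` on the cone of a point passes to higher points. Beyond `K`, for rational
  -- `r`, it also passes back down, so `x` can be fixed before the times are considered.
  obtain ⟨K, hK, hKE⟩ := exists_countable_cone_iff hP
    (D := fun (r : ℚ) x => ∀ y, x ≤ y → H y r = H x r) (by
      intro r x y hxy h z hyz
      rw [h z (hxy.trans hyz), h y hxy])
  obtain ⟨x, -, hxA, hxK⟩ := hbig univ (by rwa [image_univ]) K hK
  -- Real induction: the set of good times is closed, contains 0, and has points in `(t, u]` for
  -- each of its points `t < 1` and each `u > t`.
  have hE : Icc (0 : ℝ) 1 ⊆ {t | ∀ y, x ≤ y → H y t = H x t} := by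
    refine IsClosed.Icc_subset_of_forall_exists_gt ?_ ?_ ?_
    · refine IsClosed.inter ?_ isClosed_Icc
      simp only [ofPred_forall]
      exact isClosed_iInter fun y => isClosed_iInter fun _ => isClosed_eq (hHp y) (hHp x)
    · intro y _
      rw [hc, hc]
    · rintro t ⟨ht, ht0, ht1⟩ u hu
      obtain ⟨U, hU, htU, 𝒩, h𝒩, hN, hsep⟩ := hX (H x t)
      -- Each `y ≥ x` has `H y t = H x t ∈ U`, hence stays in `U` for some time `1 / (n + 1)`. The
      -- next cones `y`, `z` make this time uniform: first on intervals, then on the whole cone of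
      -- `z`.
      let O : ℕ → Set P := fun n => {y | ∀ s ∈ Icc t (t + 1 / ((n : ℝ) + 1)), H y s ∈ U}
      have hO : ∀ n, IsOpen (O n) := by
        intro n
        rw [isOpen_iff_mem_nhds]
        intro y hy
        exact isCompact_Icc.eventually_forall_of_forall_eventually fun s hs =>
          hH.continuousAt.eventually (hU.mem_nhds (hy s hs))
      have hcov : ∀ y, x ≤ y → ∃ n, y ∈ O n := by
        intro y hxy
        have : H y ⁻¹' U ∈ 𝓝 t := (hHp y).continuousAt (hU.mem_nhds (by rw [ht y hxy]; exact htU))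
        obtain ⟨ε, hε, hb⟩ := Metric.mem_nhds_iff.1 this
        obtain ⟨n, hn⟩ := exists_nat_one_div_lt hε
        refine ⟨n, fun s hs => hb ?_⟩
        rw [Metric.mem_ball, Real.dist_eq, abs_of_nonneg (by linarith [hs.1])]
        linarith [hs.2]
      obtain ⟨K₁, hK₁, h₁⟩ := exists_countable_Icc_subset hP hO hcov
      obtain ⟨y, hxy, hyA, hyK⟩ := hbig _ hxA K₁ hK₁
      obtain ⟨K₂, hK₂, h₂⟩ := exists_countable_Ici_subset hP (h₁ y hxy hyK)
      obtain ⟨z, hyz, hzA, hzK⟩ := hbig _ hyA K₂ hK₂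
      obtain ⟨n, hn⟩ := h₂ z hyz hzK
      set δ : ℝ := 1 / ((n : ℝ) + 1) with hδ
      have hδ0 : 0 < δ := Nat.one_div_pos_of_nat
      -- The maps at rational times in `[t, t + δ]` send the cone of `z` into `U`, so they all
      -- become constant on the cone of some higher `w`.
      obtain ⟨K₃, hK₃, h₃⟩ := exists_countable_cone_eq hP (ι := {r : ℚ // (r : ℝ) ∈ Icc t (t + δ)})
        (isClosed_Ici z) (f := fun r p => H p r) (fun r => hHt _)
        (fun r p hp => hn hp _ r.2) h𝒩 hN hsep
      obtain ⟨w, hzw, -, hwK⟩ := hbig _ hzA K₃ hK₃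
      obtain ⟨r, hr1, hr2⟩ := exists_rat_btwn (show t < min u (t + δ) from
        lt_min hu (by linarith))
      refine ⟨r, ?_, hr1, hr2.le.trans (min_le_left _ _)⟩
      refine hKE x hxK w (hxy.trans (hyz.trans hzw)) r ?_
      intro v hwv
      exact (h₃ w hzw hwK v (le_trans hzw hwv) hwv
        ⟨r, hr1.le, hr2.le.trans (min_le_right _ _)⟩).symm
  refine hxA (Set.Subsingleton.countable ?_)
  rintro _ ⟨y, hy, rfl⟩ _ ⟨z, hz, rfl⟩
  have h1 := hE ⟨zero_le_one, le_rfl⟩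
  exact (h1 y hy).trans (h1 z hz).symm

end Separation

theorem treeLike_subtype (C : Set P) : TreeLike C where
  wellFounded_lt := InvImage.wf Subtype.val (wellFounded_lt (P := P))
  le_or_le x y z hx hy := le_or_le (x : P) y z hx hy
  Iic_mem_nhds s := by
    rw [nhds_subtype]
    exact ⟨Iic (s : P), Iic_mem_nhds _, fun y hy => hy⟩
  Ioi_mem_nhds y s hys := by
    rw [nhds_subtype]
    exact ⟨Ioi (y : P), Ioi_mem_nhds _ _ hys, fun y hy => hy⟩
  exists_upper s N hN := by
    rw [nhds_subtype] at hN ⊢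
    obtain ⟨N', hN', hsub⟩ := hN
    obtain ⟨V, hV, h1, h2, h3⟩ := exists_upper (s : P) N' hN'
    exact ⟨Subtype.val ⁻¹' V, Filter.preimage_mem_comap hV, fun y hy => hsub (h1 hy),
      fun y hy => h2 hy, fun y hy z hyz hzs => h3 y hy z hyz hzs⟩
  isClosed_Iic k := (isClosed_Iic (k : P)).preimage continuous_subtype_val

theorem _root_.OmegaOneCompact.subtype_of_isClosed {Y : Type u} [TopologicalSpace Y]
    (hY : OmegaOneCompact Y) {C : Set Y} (hC : IsClosed C) : OmegaOneCompact C := by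
  intro D hD hd
  have h1 : IsClosed (Subtype.val '' D) := hC.isClosedEmbedding_subtypeVal.isClosedMap D hD
  have h2 : IsDiscrete (Subtype.val '' D) := hd.image IsInducing.subtypeVal
  exact countable_of_injective_of_countable_image Subtype.val_injective.injOn (hY _ h1 h2)

/-- Well-founded induction on `k`. If some `s < k` has `[s, k]` mapped into a separated open set,
split at `s`. Otherwise `k` is isolated in `Iic k`, so `Iio k` is closed, hence `ω₁`-compact, and
the homotopy theorem applies to it by the induction hypothesis. -/
theorem countable_image_Iic {X : Type v} [TopologicalSpace X] [T2Space X] (hP : OmegaOneCompact P)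
    (hX : LocallySeparated X) {H : P → ℝ → X} (hH : Continuous fun p : P × ℝ => H p.1 p.2) {c : X}
    (hc : ∀ p, H p 0 = c) (k : P) : ((fun p => H p 1) '' Iic k).Countable := by
  have hf : Continuous fun p => H p 1 := hH.comp (Continuous.prodMk_left 1)
  refine wellFounded_lt.induction (C := fun k => ((fun p => H p 1) '' Iic k).Countable) k ?_
  intro k ih
  obtain ⟨U, hU, hkU, 𝒩, h𝒩, hN, hsep⟩ := hX (H k 1)
  obtain ⟨V, hV, hVU, hVk, hup⟩ := exists_upper k _ (hf.continuousAt (hU.mem_nhds hkU))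
  by_cases hs : ∃ s ∈ V, s < k
  · obtain ⟨s, hsV, hsk⟩ := hs
    refine ((ih s hsk).union (countable_image_Icc hP (s := s) (k := k) hf (U := U) ?_ h𝒩 hN
      hsep)).mono ?_
    · exact fun x hx => hVU (hup s hsV x hx.1 hx.2)
    · rintro _ ⟨x, hx, rfl⟩
      rcases le_or_le x s k hx hsk.le with h | h
      · exact Or.inl ⟨x, h, rfl⟩
      · exact Or.inr ⟨x, ⟨h, hx⟩, rfl⟩
  · push Not at hs
    have hC : IsClosed (Iio k) := by
      have : Iio k = Iic k ∩ (interior V)ᶜ := by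
        ext y
        constructor
        · exact fun hy => ⟨le_of_lt hy, fun hyV => hs y (interior_subset hyV) hy⟩
        · rintro ⟨h1, h2⟩
          refine lt_of_le_of_ne h1 ?_
          rintro rfl
          exact h2 (mem_interior_iff_mem_nhds.2 hV)
      rw [this]
      exact (isClosed_Iic k).inter isOpen_interior.isClosed_compl
    have := treeLike_subtype (Iio k)
    have hcount := countable_range_of_countable_image_Iic (hP.subtype_of_isClosed hC) hX
      (H := fun p t => H p t) (hH.comp (by fun_prop :
        Continuous fun p : Iio k × ℝ => ((p.1 : P), p.2))) (c := c) (fun p => hc p) (by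
        intro s
        refine (ih s s.2).mono ?_
        rintro _ ⟨x, hx, rfl⟩
        exact ⟨x, hx, rfl⟩)
    refine (hcount.union (countable_singleton (H k 1))).mono ?_
    rintro _ ⟨x, hx, rfl⟩
    rcases (show x ≤ k from hx).eq_or_lt with h | h
    · exact Or.inr (by simp [h])
    · exact Or.inl ⟨⟨x, h⟩, rfl⟩

/-- The end of a homotopy starting at a constant map has countable image. -/
theorem countable_range_of_homotopy {X : Type v} [TopologicalSpace X] [T2Space X]
    (hP : OmegaOneCompact P) (hX : LocallySeparated X) {h : P × unitInterval → X}
    (hh : Continuous h) {c : X} (hc : ∀ p, h (p, 0) = c) :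
    (range fun p => h (p, 1)).Countable := by
  let H : P → ℝ → X := fun p t => h (p, projIcc 0 1 zero_le_one t)
  have hH : Continuous fun p : P × ℝ => H p.1 p.2 :=
    hh.comp (continuous_fst.prodMk (continuous_projIcc.comp continuous_snd))
  have h0 : ∀ p, H p 0 = c := fun p => by
    simp only [H, projIcc_left]
    exact hc p
  have h1 : ∀ p, H p 1 = h (p, 1) := fun p => by
    simp only [H, projIcc_right]
    rfl
  have := countable_range_of_countable_image_Iic hP hX hH h0 (countable_image_Iic hP hX hH h0)
  simpa only [h1] using this

theorem not_contractibleSpace {X : Type v} [TopologicalSpace X] [T2Space X]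
    (hP : OmegaOneCompact P) (hX : LocallySeparated X) (hunc : Uncountable P) {f : P → X}
    (hf : Continuous f) (hinj : Function.Injective f) : ¬ ContractibleSpace X := by
  intro _
  obtain ⟨c, ⟨F⟩⟩ := id_nullhomotopic X
  -- `F` runs from the identity to a constant; its reverse starts at the constant map.
  have := countable_range_of_homotopy hP hX (h := fun p => F.symm (p.2, f p.1))
    (F.symm.continuous.comp (continuous_snd.prodMk (hf.comp continuous_fst))) (c := c)
    (fun p => by simp)
  have h1 : (range f).Countable := by simpa using this
  rw [← image_univ] at h1
  exact not_countable (α := P)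
    (countable_univ_iff.1 (countable_of_injective_of_countable_image hinj.injOn h1))

end TreeLike

/-! ### Hausdorff trees are tree-like, and Suslin trees are `ω₁`-compact. -/

namespace IsOrderTree

variable {T : Type u} [PartialOrder T]

theorem isMin_or_covBy_or_isSuccLimit (x : T) :
    IsMin x ∨ (∃ z, z ⋖ x) ∨ Order.IsSuccLimit x := by
  by_cases h1 : IsMin x
  · exact Or.inl h1
  by_cases h2 : ∃ z, z ⋖ x
  · exact Or.inr (Or.inl h2)
  · push Not at h2
    exact Or.inr (Or.inr ⟨h1, fun z => h2 z⟩)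

theorem isSuccLimit_of_Iio_eq {x y : T} (hxy : Iio x = Iio y) (h : Order.IsSuccLimit y) :
    Order.IsSuccLimit x := by
  constructor
  · intro hx
    obtain ⟨w, hw⟩ := not_isMin_iff.1 h.1
    have : w ∈ Iio x := hxy ▸ hw
    exact (this.trans_le (hx (le_of_lt this))).false
  · intro z hz
    have hzy : z ∈ Iio y := hxy ▸ hz.lt
    refine h.2 z ⟨hzy, fun w hzw hwy => ?_⟩
    have : w ∈ Iio x := hxy ▸ hwy
    exact hz.2 hzw this

theorem isOpen_Ioc [TopologicalSpace T] [IsTreeTopology T] (a b : T) : IsOpen (Ioc a b) := by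
  rw [IsTreeTopology.topology_eq (T := T)]
  exact TopologicalSpace.isOpen_generateFrom_of_mem (Or.inl ⟨a, b, rfl⟩)

theorem isOpen_Iic [TopologicalSpace T] [IsTreeTopology T] (b : T) : IsOpen (Iic b) := by
  rw [IsTreeTopology.topology_eq (T := T)]
  exact TopologicalSpace.isOpen_generateFrom_of_mem (Or.inr ⟨b, rfl⟩)

variable [IsOrderTree T]

theorem le_or_le_of_le {x y z : T} (hx : x ≤ z) (hy : y ≤ z) : x ≤ y ∨ y ≤ x := by
  rcases hx.eq_or_lt with rfl | hx
  · exact Or.inr hy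
  rcases hy.eq_or_lt with rfl | hy
  · exact Or.inl hx.le
  have := IsOrderTree.isWellOrder_Iio z
  rcases trichotomous_of (fun a b : Iio z => a < b) ⟨x, hx⟩ ⟨y, hy⟩ with h | h | h
  · exact Or.inl (le_of_lt h)
  · exact Or.inl (Subtype.mk.inj h).le
  · exact Or.inr (le_of_lt h)

theorem wellFounded_lt : WellFounded (fun a b : T => a < b) := by
  refine ⟨fun x => ⟨_, fun y hy => ?_⟩⟩
  have := IsOrderTree.isWellOrder_Iio x
  have hwf : WellFounded (fun a b : Iio x => a < b) := IsWellFounded.wf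
  have key : ∀ z : Iio x, Acc (fun a b : T => a < b) z := fun z =>
    hwf.induction (C := fun z : Iio x => Acc (fun a b : T => a < b) z) z
      fun w ih => ⟨_, fun v hv => ih ⟨v, lt_trans hv w.2⟩ hv⟩
  exact key ⟨y, hy⟩

theorem exists_minimal {p : T → Prop} {x : T} (hx : p x) : ∃ m, p m ∧ ∀ y, y < m → ¬ p y := by
  have hA : {y | p y}.Nonempty := ⟨x, hx⟩
  exact ⟨wellFounded_lt.min _ hA, wellFounded_lt.min_mem _ hA,
    fun y hy hpy => wellFounded_lt.not_lt_min _ (x := y) hpy hy⟩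

variable [TopologicalSpace T] [IsTreeTopology T]

theorem exists_Ioc_subset {s : T} {N : Set T} (hN : N ∈ 𝓝 s) :
    s ∈ N ∧ (IsMin s ∨ ∃ a < s, Ioc a s ⊆ N) := by
  refine ⟨mem_of_mem_nhds hN, ?_⟩
  by_cases hs : IsMin s
  · exact Or.inl hs
  right
  obtain ⟨a₀, ha₀⟩ := not_isMin_iff.1 hs
  obtain ⟨O, hON, hO, hsO⟩ := mem_nhds_iff.1 hN
  suffices ∃ a < s, Ioc a s ⊆ O by
    obtain ⟨a, ha, h⟩ := this
    exact ⟨a, ha, h.trans hON⟩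
  rw [IsTreeTopology.topology_eq (T := T)] at hO
  clear hON hN
  induction hO with
  | basic U hU =>
    rcases hU with ⟨a, b, rfl⟩ | ⟨b, rfl⟩
    · exact ⟨a, hsO.1, Ioc_subset_Ioc_right hsO.2⟩
    · exact ⟨a₀, ha₀, fun w hw => hw.2.trans hsO⟩
  | univ => exact ⟨a₀, ha₀, subset_univ _⟩
  | inter U V _ _ hU hV =>
    obtain ⟨a, ha, haU⟩ := hU hsO.1
    obtain ⟨b, hb, hbV⟩ := hV hsO.2
    rcases le_or_le_of_le ha.le hb.le with h | h
    · exact ⟨b, hb, fun w hw => ⟨haU ⟨h.trans_lt hw.1, hw.2⟩, hbV hw⟩⟩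
    · exact ⟨a, ha, fun w hw => ⟨haU hw, hbV ⟨h.trans_lt hw.1, hw.2⟩⟩⟩
  | sUnion 𝒰 _ ih =>
    obtain ⟨U, hU, hsU⟩ := hsO
    obtain ⟨a, ha, h⟩ := ih U hU hsU
    exact ⟨a, ha, h.trans (subset_sUnion_of_mem hU)⟩

/-- The critical case is a limit point `y` outside `Iic k` with all its predecessors in `Iic k` and
`k` not below `y`. The least `m ≤ k` that is not below `y` then has the same predecessors as `y`,
and the Hausdorff condition forces `m = y`. -/
theorem isClosed_Iic [IsHausdorffTree T] (k : T) : IsClosed (Iic k) := by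
  rw [← isOpen_compl_iff, isOpen_iff_mem_nhds]
  intro y hy
  have hy : ¬ y ≤ k := hy
  have hIoc : ∀ z, z < y → ¬ z ≤ k → (Iic k)ᶜ ∈ 𝓝 y := fun z hz hzk =>
    Filter.mem_of_superset ((isOpen_Ioc z y).mem_nhds ⟨hz, le_rfl⟩)
      fun w hw hwk => hzk (hw.1.le.trans hwk)
  rcases isMin_or_covBy_or_isSuccLimit y with h | ⟨z, hz⟩ | h
  · refine Filter.mem_of_superset ((isOpen_Iic y).mem_nhds le_rfl) fun w hw hwk => hy ?_
    exact (h hw).trans hwk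
  · refine Filter.mem_of_superset ((isOpen_Ioc z y).mem_nhds ⟨hz.lt, le_rfl⟩) fun w hw hwk => hy ?_
    have : w = y := hw.2.eq_of_not_lt fun h => hz.2 hw.1 h
    exact this ▸ hwk
  · by_cases hex : ∃ z < y, ¬ z ≤ k
    · obtain ⟨z, hz, hzk⟩ := hex
      exact hIoc z hz hzk
    push Not at hex
    by_cases hky : k < y
    · exact Filter.mem_of_superset ((isOpen_Ioc k y).mem_nhds ⟨hky, le_rfl⟩)
        fun w hw hwk => (hw.1.trans_le hwk).false
    exfalso
    obtain ⟨m, ⟨hmk, hmy⟩, hmin⟩ := exists_minimal (p := fun w => w ≤ k ∧ ¬ w < y) (x := k)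
      ⟨le_rfl, hky⟩
    have hIio : Iio m = Iio y := by
      ext w
      constructor
      · intro hw
        by_contra hwy
        exact hmin w hw ⟨(le_of_lt hw).trans hmk, hwy⟩
      · intro hw
        rcases le_or_le_of_le (hex w hw) hmk with h1 | h1
        · refine lt_of_le_of_ne h1 ?_
          rintro rfl
          exact hmy hw
        · exact absurd (h1.trans_lt hw) hmy
    exact hy (IsHausdorffTree.eq_of_Iio_eq m y (isSuccLimit_of_Iio_eq hIio h) h hIio ▸ hmk)

instance [IsHausdorffTree T] : TreeLike T where
  wellFounded_lt := wellFounded_lt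
  le_or_le _ _ _ := le_or_le_of_le
  Iic_mem_nhds s := (isOpen_Iic s).mem_nhds le_rfl
  Ioi_mem_nhds y s hys := Filter.mem_of_superset ((isOpen_Ioc y s).mem_nhds ⟨hys, le_rfl⟩)
    fun _ h => h.1
  exists_upper s N hN := by
    obtain ⟨hs, hm | ⟨a, ha, haN⟩⟩ := exists_Ioc_subset hN
    · have : Iic s = {s} := subset_antisymm (fun w hw => le_antisymm hw (hm hw)) (by simp)
      refine ⟨Iic s, (isOpen_Iic s).mem_nhds le_rfl, ?_, le_rfl, fun y _ z _ hz => hz⟩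
      rw [this]
      simpa using hs
    · exact ⟨Ioc a s, (isOpen_Ioc a s).mem_nhds ⟨ha, le_rfl⟩, haN, fun w hw => hw.2,
        fun y hy z hyz hzs => ⟨hy.1.trans_le hyz, hzs⟩⟩
  isClosed_Iic := isClosed_Iic

/-- At a least counterexample `m`, some `(a, m]` with `a < m` meets `D` at most in `m`. So `D` has
below `m` at most the point `a` besides its finitely many points below `a`. -/
theorem finite_inter_Iio {D : Set T} (hD : IsClosed D) (hd : IsDiscrete D) (x : T) :
    (D ∩ Iio x).Finite := by
  by_contra hx
  obtain ⟨m, hm, hmin⟩ := exists_minimal (p := fun x => ¬ (D ∩ Iio x).Finite) hx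
  have h := isClosed_and_discrete_iff.1 ⟨hD, hd⟩ m
  rw [Filter.disjoint_principal_right, mem_nhdsWithin_iff_exists_mem_nhds_inter] at h
  obtain ⟨N, hN, hND⟩ := h
  obtain ⟨-, hm' | ⟨a, ha, haN⟩⟩ := exists_Ioc_subset hN
  · refine hm (Set.finite_empty.subset ?_)
    rintro w ⟨-, hw⟩
    exact (lt_of_lt_of_le hw (hm' (le_of_lt hw))).false
  · refine hm (((not_not.1 (hmin a ha)).union (finite_singleton a)).subset ?_)
    rintro w ⟨hwD, hw⟩
    rcases le_or_le_of_le ha.le (le_of_lt hw) with h | h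
    · rcases h.eq_or_lt with h | h
      · exact Or.inr h.symm
      · exact absurd hwD (hND ⟨haN ⟨h, le_of_lt hw⟩, ne_of_lt hw⟩)
    · rcases h.eq_or_lt with h | h
      · exact Or.inr h
      · exact Or.inl ⟨hwD, h⟩

/-- Sort a closed discrete set by the finite number of its own members below each point: each of
these countably many levels is an antichain. -/
theorem omegaOneCompact_of_countable_antichains
    (hA : ∀ A : Set T, IsAntichain (· ≤ ·) A → A.Countable) : OmegaOneCompact T := by
  intro D hD hd
  have hfin := finite_inter_Iio hD hd
  have : D ⊆ ⋃ n : ℕ, {d ∈ D | (D ∩ Iio d).ncard = n} := fun d hd => mem_iUnion.2 ⟨_, hd, rfl⟩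
  refine (countable_iUnion fun n => hA _ ?_).mono this
  rintro a ⟨ha, han⟩ b ⟨hb, hbn⟩ hne hab
  have hlt : a < b := lt_of_le_of_ne hab hne
  have : (D ∩ Iio a).ncard < (D ∩ Iio b).ncard := by
    refine Set.ncard_lt_ncard ⟨fun w hw => ⟨hw.1, lt_trans hw.2 hlt⟩, fun h => ?_⟩ (hfin b)
    exact lt_irrefl a (h ⟨ha, hlt⟩).2
  omega

end IsOrderTree

/-! ### Consequences of height `ω₁`. -/

section Height

variable {T : Type u} [PartialOrder T] [IsOrderTree T]

theorem succ_pointHeight_le_treeHeight (x : T) : Order.succ (pointHeight x) ≤ treeHeight T :=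
  le_ciSup (f := fun x : T => Order.succ (pointHeight x)) Ordinal.bddAbove_of_small x

theorem countable_Iic_of_treeHeight (h : treeHeight T = ω₁) (x : T) : (Iic x).Countable := by
  have hlt : pointHeight x < ω₁ :=
    h ▸ (Order.lt_succ (pointHeight x)).trans_le (succ_pointHeight_le_treeHeight x)
  have hc : (pointHeight x).card < Cardinal.aleph 1 := by
    rw [← Cardinal.lt_ord]
    simpa using hlt
  have h1 : (Iio x).Countable := by
    rw [← Cardinal.le_aleph0_iff_set_countable, ← Order.lt_succ_iff, Cardinal.succ_aleph0]
    exact hc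
  rw [← Iio_insert]
  exact h1.insert x

theorem uncountable_of_treeHeight (h : treeHeight T = ω₁) : Uncountable T := by
  rw [← not_countable_iff]
  intro hT
  refine lt_irrefl (ω₁ : Ordinal.{u}) ?_
  conv_lhs => rw [← h]
  refine Ordinal.iSup_lt_omega_one fun x => ?_
  refine (Cardinal.isSuccLimit_omega 1).succ_lt ?_
  rw [← h]
  exact (Order.lt_succ (pointHeight x)).trans_le (succ_pointHeight_le_treeHeight x)

end Height

/-! ### Neighborhoods in the road space and the embedding of the tree. -/

namespace RoadSpace

variable {T : Type u} [PartialOrder T]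

theorem road_of_mem {x y : T} (h : x ⋖ y) (t : Ioo (0 : ℝ) 1) : road h t = edge x y h t := by
  simp [road]

theorem road_zero {x y : T} (h : x ⋖ y) : road h 0 = node x := by simp [road]

theorem road_one {x y : T} (h : x ⋖ y) : road h 1 = node y := by simp [road]

theorem one_div_natCast_le_one {n : ℕ} (hn : 1 ≤ n) : 1 / (n : ℝ) ≤ 1 := by
  rw [div_le_one (by exact_mod_cast hn)]
  exact_mod_cast hn

/-- Points in the half-open initial portion of a road. -/
theorem road_Ico_cases {x y : T} (h : x ⋖ y) {t b : ℝ} (hb : b ≤ 1) (ht : t ∈ Ico 0 b) :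
    road h t = node x ∨ ∃ s : Ioo (0 : ℝ) 1, s < b ∧ road h t = edge x y h s := by
  rcases ht.1.eq_or_lt with rfl | h0
  · exact Or.inl (road_zero h)
  · exact Or.inr ⟨⟨t, h0, ht.2.trans_le hb⟩, ht.2, road_of_mem h ⟨t, h0, ht.2.trans_le hb⟩⟩

theorem road_Ioc_cases {x y : T} (h : x ⋖ y) {t a : ℝ} (ha : 0 ≤ a) (ht : t ∈ Ioc a 1) :
    road h t = node y ∨ ∃ s : Ioo (0 : ℝ) 1, a < s ∧ road h t = edge x y h s := by
  rcases ht.2.eq_or_lt with rfl | h1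
  · exact Or.inl (road_one h)
  · exact Or.inr ⟨⟨t, ha.trans_lt ht.1, h1⟩, ht.1, road_of_mem h ⟨t, ha.trans_lt ht.1, h1⟩⟩

theorem isOpen_of_isBasicOpen {U : Set (RoadSpace T)} (hU : IsBasicOpen U) : IsOpen U :=
  TopologicalSpace.isOpen_generateFrom_of_mem hU

theorem node_mem_star (x : T) (n : ℕ) : node x ∈ star x n := Or.inl rfl

theorem star_cases {x : T} {n : ℕ} (hn : 1 ≤ n) {q : RoadSpace T} (hq : q ∈ star x n) :
    q = node x ∨ ∃ (y : T) (h : x ⋖ y) (s : Ioo (0 : ℝ) 1), s < 1 / (n : ℝ) ∧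
      q = edge x y h s := by
  rcases hq with hq | hq
  · exact Or.inl hq
  · obtain ⟨y, h, t, ht, rfl⟩ := by simpa only [mem_iUnion] using hq
    rcases road_Ico_cases h (one_div_natCast_le_one hn) ht with h' | ⟨s, hs, h'⟩
    · exact Or.inl h'
    · exact Or.inr ⟨y, h, s, hs, h'⟩

/-- Together with the three lemmas that follow, this reduces local statements to checks on nodes and
open edges, one lemma per kind of basic neighborhood. -/
theorem eventually_edge {p : RoadSpace T → Prop} {x y : T} {h : x ⋖ y} {t : Ioo (0 : ℝ) 1} {ε : ℝ}
    (hε : 0 < ε) (hp : ∀ s : Ioo (0 : ℝ) 1, |(s : ℝ) - t| < ε → p (edge x y h s)) :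
    ∀ᶠ q in 𝓝 (edge x y h t), p q := by
  have hU := isOpen_of_isBasicOpen (IsBasicOpen.interval h (max 0 (t - ε)) (min 1 (t + ε))
    (le_max_left _ _) (min_le_left _ _))
  refine Filter.mem_of_superset (hU.mem_nhds ⟨t, ⟨max_lt t.2.1 (by linarith),
    lt_min t.2.2 (by linarith)⟩, road_of_mem h t⟩) ?_
  rintro _ ⟨s, ⟨hs1, hs2⟩, rfl⟩
  rw [max_lt_iff] at hs1
  rw [lt_min_iff] at hs2
  have := road_of_mem h ⟨s, hs1.1, hs2.1⟩
  rw [this]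
  exact hp _ (by rw [abs_lt]; constructor <;> simp only <;> linarith [hs1.2, hs2.2])

theorem eventually_node_of_isMin {p : RoadSpace T → Prop} {x : T} (hx : IsMin x) {n : ℕ}
    (hn : 1 ≤ n) (hnode : p (node x))
    (hstar : ∀ y (h : x ⋖ y) (s : Ioo (0 : ℝ) 1), s < 1 / (n : ℝ) → p (edge x y h s)) :
    ∀ᶠ q in 𝓝 (node x), p q := by
  refine Filter.mem_of_superset ((isOpen_of_isBasicOpen (IsBasicOpen.minimal x hx n hn)).mem_nhds
    (node_mem_star x n)) fun q hq => ?_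
  rcases star_cases hn hq with rfl | ⟨y, h, s, hs, rfl⟩
  · exact hnode
  · exact hstar y h s hs

theorem eventually_node_of_covBy {p : RoadSpace T → Prop} {z x : T} (hzx : z ⋖ x) {n : ℕ}
    (hn : 1 ≤ n) (hnode : p (node x))
    (hstar : ∀ y (h : x ⋖ y) (s : Ioo (0 : ℝ) 1), s < 1 / (n : ℝ) → p (edge x y h s))
    (hbelow : ∀ s : Ioo (0 : ℝ) 1, 1 - 1 / (n : ℝ) < s → p (edge z x hzx s)) :
    ∀ᶠ q in 𝓝 (node x), p q := by
  refine Filter.mem_of_superset ((isOpen_of_isBasicOpen (IsBasicOpen.successor hzx n hn)).mem_nhds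
    (Or.inl (node_mem_star x n))) fun q hq => ?_
  rcases hq with hq | ⟨t, ht, rfl⟩
  · rcases star_cases hn hq with rfl | ⟨y, h, s, hs, rfl⟩
    · exact hnode
    · exact hstar y h s hs
  · rcases road_Ioc_cases hzx (sub_nonneg.2 (one_div_natCast_le_one hn)) ht with h | ⟨s, hs, h⟩
    · exact h ▸ hnode
    · exact h ▸ hbelow s hs

theorem eventually_node_of_isSuccLimit {p : RoadSpace T → Prop} {z x : T}
    (hx : Order.IsSuccLimit x) (hzx : z < x) {n : ℕ} (hn : 1 ≤ n)
    (hnode : ∀ w, z < w → w ≤ x → p (node w))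
    (hseg : ∀ a b (h : a ⋖ b) s, z ≤ a → b ≤ x → p (edge a b h s))
    (hstar : ∀ w, z < w → w ≤ x → ∀ y (h : w ⋖ y) (s : Ioo (0 : ℝ) 1), s < 1 / (n : ℝ) →
      p (edge w y h s)) :
    ∀ᶠ q in 𝓝 (node x), p q := by
  refine Filter.mem_of_superset ((isOpen_of_isBasicOpen (IsBasicOpen.limit hx hzx n hn)).mem_nhds
    (Or.inr (mem_biUnion (show x ∈ Ioc z x from ⟨hzx, le_rfl⟩) (node_mem_star x n)))) fun q hq => ?_
  rcases hq with hq | hq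
  · cases q with
    | node w => exact hnode w hq.1 hq.2.le
    | edge a b h s => exact hseg a b h s hq.1 hq.2
  · obtain ⟨w, hw, hq⟩ := mem_iUnion₂.1 hq
    rcases star_cases hn hq with rfl | ⟨y, h, s, hs, rfl⟩
    · exact hnode w hw.1 hw.2
    · exact hstar w hw.1 hw.2 y h s hs

theorem continuous_node [TopologicalSpace T] [IsTreeTopology T] :
    Continuous (node : T → RoadSpace T) := by
  have hstar : ∀ (x : T) (n : ℕ), 1 ≤ n → ∀ w : T, node w ∈ star x n → w = x := by
    intro x n hn w hw
    rcases star_cases hn hw with h | ⟨_, _, _, _, h⟩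
    · exact node.inj h
    · cases h
  refine continuous_generateFrom_iff.2 ?_
  intro U hU
  cases hU with
  | interval h a b ha hb =>
    convert isOpen_empty
    rw [eq_empty_iff_forall_notMem]
    rintro w ⟨t, ht, h'⟩
    rw [road_of_mem h ⟨t, ha.trans_lt ht.1, ht.2.trans_le hb⟩] at h'
    cases h'
  | minimal x hx n hn =>
    convert IsOrderTree.isOpen_Iic x
    ext w
    constructor
    · exact fun hw => (hstar x n hn w hw).le
    · intro hw
      obtain rfl : w = x := le_antisymm hw (hx hw)
      exact node_mem_star w n
  | @successor z x h n hn =>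
    convert IsOrderTree.isOpen_Ioc z x
    ext w
    constructor
    · rintro (hw | ⟨t, ht, h'⟩)
      · obtain rfl := hstar x n hn w hw
        exact ⟨h.lt, le_rfl⟩
      · rcases road_Ioc_cases h (sub_nonneg.2 (one_div_natCast_le_one hn)) ht with h₁ | ⟨s, -, h₁⟩
        · rw [h₁] at h'
          obtain rfl := node.inj h'
          exact ⟨h.lt, le_rfl⟩
        · rw [h₁] at h'
          cases h'
    · rintro ⟨h1, h2⟩
      obtain rfl : w = x := h2.eq_of_not_lt fun h' => h.2 h1 h'
      exact Or.inl (node_mem_star w n)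
  | @limit z x hx h n hn =>
    convert IsOrderTree.isOpen_Ioc z x
    ext w
    constructor
    · rintro (hw | hw)
      · exact ⟨hw.1, hw.2.le⟩
      · obtain ⟨v, hv, hw⟩ := mem_iUnion₂.1 hw
        obtain rfl := hstar v n hn w hw
        exact hv
    · exact fun hw => Or.inr (mem_biUnion hw (node_mem_star w n))

/-- The last point of the tree below a point of the road space. -/
def base : RoadSpace T → T
  | node x => x
  | edge x _ _ _ => x

open Classical in
/-- The function which measures how far a point has moved along the roads that start at `w`. -/
noncomputable def progress (w : T) : RoadSpace T → ℝ
  | node v => if w < v then 1 else 0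
  | edge a _ _ t => if a = w then t else if w < a then 1 else 0

theorem progress_edge_self (a b : T) (h : a ⋖ b) (t : Ioo (0 : ℝ) 1) :
    progress a (edge a b h t) = t := by
  simp [progress]

/-- `progress w` takes values strictly between 0 and 1 only inside roads starting at `w`, so such a
value determines the start and the position, though not the end of the road. -/
theorem progress_edge_eq {w a b : T} {h : a ⋖ b} {s t : Ioo (0 : ℝ) 1}
    (hst : progress w (edge a b h s) = t) : a = w ∧ s = t := by
  by_cases ha : a = w
  · refine ⟨ha, Subtype.ext ?_⟩
    simpa [progress, ha] using hst
  · have := t.2.1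
    have := t.2.2
    by_cases hw : w < a
    · simp only [progress, ha, hw, if_true, if_false] at hst
      linarith
    · simp only [progress, ha, hw, if_false] at hst
      linarith

theorem progress_node_ne {w v : T} (t : Ioo (0 : ℝ) 1) : progress w (node v) ≠ t := by
  intro hst
  have := t.2.1
  have := t.2.2
  by_cases hw : w < v
  · simp only [progress, hw, if_true] at hst
    linarith
  · simp only [progress, hw, if_false] at hst
    linarith

/-- Points on two different roads starting at the same point, both at distance at least
`1 / (m + 1)` from it. -/
def Forked (m : ℕ) (p q : RoadSpace T) : Prop :=
  ∃ (w y y' : T) (h : w ⋖ y) (h' : w ⋖ y') (s s' : Ioo (0 : ℝ) 1), p = edge w y h s ∧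
    q = edge w y' h' s' ∧ y ≠ y' ∧ 1 / ((m : ℝ) + 1) ≤ s ∧ 1 / ((m : ℝ) + 1) ≤ s'

/-- This makes `{q | base q ≤ x}` open. The starting nodes of its points form a chain, although
roads leaving that chain may be uncountably many. -/
theorem eventually_base_le (x : T) (p : RoadSpace T) (hp : base p ≤ x) :
    ∀ᶠ q in 𝓝 p, base q ≤ x := by
  cases p with
  | edge a b h t => exact eventually_edge one_pos fun _ _ => hp
  | node v =>
    change v ≤ x at hp
    rcases IsOrderTree.isMin_or_covBy_or_isSuccLimit v with hv | ⟨z, hz⟩ | hv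
    · exact eventually_node_of_isMin hv le_rfl hp fun _ _ _ _ => hp
    · exact eventually_node_of_covBy hz le_rfl hp (fun _ _ _ _ => hp)
        fun _ _ => hz.le.trans hp
    · obtain ⟨z, hz⟩ := not_isMin_iff.1 hv.1
      exact eventually_node_of_isSuccLimit hv hz le_rfl (fun _ _ hw => hw.trans hp)
        (fun a b h _ _ hb => h.le.trans (hb.trans hp)) fun _ _ hw _ _ _ _ => hw.trans hp

/-! ### Separation properties of the road space. -/

section

variable [IsOrderTree T]

theorem le_of_lt_of_covBy {w z x : T} (h : z ⋖ x) (hw : w < x) : w ≤ z := by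
  rcases IsOrderTree.le_or_le_of_le hw.le h.le with h' | h'
  · exact h'
  · rcases h'.eq_or_lt with h' | h'
    · exact h'.ge
    · exact absurd hw (h.2 h')

theorem continuous_progress (w : T) : Continuous (progress w) := by
  rw [continuous_iff_continuousAt]
  intro p
  rw [Metric.continuousAt_iff']
  intro ε hε
  simp only [Real.dist_eq]
  cases p with
  | edge a b h t =>
    refine eventually_edge hε fun s hs => ?_
    by_cases ha : a = w
    · simpa [progress, ha] using hs
    · simpa [progress, ha] using hε
  | node x =>
    obtain ⟨m, hm⟩ := exists_nat_one_div_lt hε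
    have hstar : ∀ v y (h : v ⋖ y) (s : Ioo (0 : ℝ) 1), s < 1 / ((m + 1 : ℕ) : ℝ) →
        |progress w (edge v y h s) - progress w (node v)| < ε := by
      intro v y h s hs
      by_cases hv : v = w
      · subst hv
        push_cast at hs
        simp only [progress, if_true, lt_irrefl, if_false, sub_zero, abs_of_pos s.2.1]
        exact hs.trans hm
      · simpa [progress, hv] using hε
    have h0 : |progress w (node x) - progress w (node x)| < ε := by simpa using hε
    have hm1 : 1 ≤ m + 1 := Nat.le_add_left 1 m
    rcases IsOrderTree.isMin_or_covBy_or_isSuccLimit x with hx | ⟨z, hz⟩ | hx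
    · exact eventually_node_of_isMin hx hm1 h0 (hstar x)
    · refine eventually_node_of_covBy hz hm1 h0 (hstar x) fun s hs => ?_
      by_cases hzw : z = w
      · subst hzw
        push_cast at hs
        have := s.2.2
        simp only [progress, if_true, hz.lt]
        rw [abs_lt]
        constructor <;> linarith
      · have : w < x ↔ w < z :=
          ⟨fun h => lt_of_le_of_ne (le_of_lt_of_covBy hz h) (Ne.symm hzw), fun h => h.trans hz.lt⟩
        by_cases hwx : w < x
        · simpa [progress, hzw, hwx, this.1 hwx] using hε
        · have hwz : ¬ w < z := fun h => hwx (this.2 h)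
          simpa [progress, hzw, hwx, hwz] using hε
    · by_cases hw : w < x
      · obtain ⟨z, hwz, hzx⟩ : ∃ z, w < z ∧ z < x := by
          by_contra! hcon
          exact hx.2 w ⟨hw, fun z h1 h2 => hcon z h1 h2⟩
        have key : ∀ v, z ≤ v → progress w (node v) = progress w (node x) := fun v hv => by
          simp [progress, hw, hwz.trans_le hv]
        refine eventually_node_of_isSuccLimit hx hzx hm1 ?_ ?_ ?_
        · intro v hv _
          rw [key v hv.le]
          exact h0
        · intro a b h s ha _
          have : w < a := hwz.trans_le ha
          simpa [progress, hw, this, this.ne'] using hε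
        · intro v hv _ y h s hs
          rw [← key v hv.le]
          exact hstar v y h s hs
      · obtain ⟨z, hzx⟩ := not_isMin_iff.1 hx.1
        have key : ∀ v, v ≤ x → progress w (node v) = progress w (node x) := fun v hv => by
          have : ¬ w < v := fun h => hw (h.trans_le hv)
          simp [progress, hw, this]
        refine eventually_node_of_isSuccLimit hx hzx hm1 ?_ ?_ ?_
        · intro v _ hv
          rw [key v hv]
          exact h0
        · intro a b h s _ hb
          have h1 : ¬ w < a := fun h' => hw (h'.trans (h.lt.trans_le hb))
          have h2 : a ≠ w := by
            rintro rfl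
            exact hw (h.lt.trans_le hb)
          simpa [progress, hw, h1, h2] using hε
        · intro v _ hv y h s hs
          rw [← key v hv]
          exact hstar v y h s hs

/-- Near a node `x`, a point of a road is either closer than `1 / (m + 1)` to the start or on a road
whose end is at most `x`. Two roads with the same start and with ends below `x` coincide, since
these ends are comparable. -/
theorem exists_not_forked (m : ℕ) (p : RoadSpace T) :
    ∃ V ∈ 𝓝 p, ∀ a ∈ V, ∀ b ∈ V, ¬ Forked m a b := by
  cases p with
  | edge a b h t =>
    refine ⟨{q | ∃ s, q = edge a b h s}, eventually_edge one_pos fun s _ => ⟨s, rfl⟩, ?_⟩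
    rintro _ ⟨s, rfl⟩ _ ⟨s', rfl⟩ ⟨w, y, y', h, h', r, r', h1, h2, hne, -⟩
    cases h1
    cases h2
    exact hne rfl
  | node x =>
    let p : RoadSpace T → Prop := fun q =>
      ∀ a b h (s : Ioo (0 : ℝ) 1), q = edge a b h s → s < 1 / ((m : ℝ) + 1) ∨ b ≤ x
    refine ⟨{q | p q}, ?_, ?_⟩
    · have hnode : ∀ v, p (node v) := by
        intro v a b h s h'
        cases h'
      have hstar : ∀ v y (h : v ⋖ y) (s : Ioo (0 : ℝ) 1), s < 1 / ((m + 1 : ℕ) : ℝ) →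
          p (edge v y h s) := by
        rintro v y h s hs a b h' s' heq
        cases heq
        exact Or.inl (by exact_mod_cast hs)
      have hle : ∀ v y (h : v ⋖ y) (s : Ioo (0 : ℝ) 1), y ≤ x → p (edge v y h s) := by
        rintro v y h s hs a b h' s' heq
        cases heq
        exact Or.inr hs
      have hm1 : 1 ≤ m + 1 := Nat.le_add_left 1 m
      rcases IsOrderTree.isMin_or_covBy_or_isSuccLimit x with hx | ⟨z, hz⟩ | hx
      · exact eventually_node_of_isMin hx hm1 (hnode x) (hstar x)
      · exact eventually_node_of_covBy hz hm1 (hnode x) (hstar x) fun s _ => hle _ _ _ _ le_rfl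
      · obtain ⟨z, hzx⟩ := not_isMin_iff.1 hx.1
        exact eventually_node_of_isSuccLimit hx hzx hm1 (fun v _ _ => hnode v)
          (fun a b h s _ hb => hle _ _ _ _ hb) fun v _ _ => hstar v
    · rintro _ h1 _ h2 ⟨w, y, y', h, h', r, r', rfl, rfl, hne, hr, hr'⟩
      have hy := (h1 _ _ _ _ rfl).resolve_left hr.not_gt
      have hy' := (h2 _ _ _ _ rfl).resolve_left hr'.not_gt
      rcases IsOrderTree.le_or_le_of_le hy hy' with h3 | h3
      · exact hne (h3.eq_of_not_lt fun h4 => h'.2 h.lt h4)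
      · exact hne (h3.eq_of_not_lt fun h4 => h.2 h'.lt h4).symm

/-- The points above the middle of the road that leads to `v`. -/
def above (v : T) : Set (RoadSpace T) :=
  {q | match q with
    | node w => v ≤ w
    | edge a b _ t => v ≤ a ∨ (b = v ∧ (1 / 2 : ℝ) < t)}

theorem isOpen_above {v : T} (hv : ¬ Order.IsSuccLimit v) : IsOpen (above v) := by
  rw [isOpen_iff_mem_nhds]
  intro p hp
  cases p with
  | edge a b h t =>
    rcases hp with hp | ⟨hb, ht⟩
    · exact eventually_edge one_pos fun s _ => Or.inl hp
    · refine eventually_edge (sub_pos.2 ht) fun s hs => Or.inr ⟨hb, ?_⟩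
      linarith [(abs_lt.1 hs).1]
  | node x =>
    have hp : v ≤ x := hp
    rcases IsOrderTree.isMin_or_covBy_or_isSuccLimit x with hx | ⟨z, hz⟩ | hx
    · exact eventually_node_of_isMin hx le_rfl hp fun _ _ _ _ => Or.inl hp
    -- With `n = 2` the incoming portion is `(1 - 1/2, 1]`, matching the threshold in `above`.
    · refine eventually_node_of_covBy hz (n := 2) one_le_two hp (fun _ _ _ _ => Or.inl hp)
        fun s hs => ?_
      rcases hp.eq_or_lt with rfl | hlt
      · refine Or.inr ⟨rfl, ?_⟩
        norm_num at hs ⊢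
        exact hs
      · exact Or.inl (le_of_lt_of_covBy hz hlt)
    · have hlt : v < x := lt_of_le_of_ne hp (by rintro rfl; exact hv hx)
      exact eventually_node_of_isSuccLimit hx hlt le_rfl (fun w hw _ => hw.le)
        (fun a b h s ha _ => Or.inl ha) fun w hw _ _ _ _ _ => Or.inl hw.le

theorem disjoint_above {v v' : T} (hne : v ≠ v') (h : Iio v = Iio v') :
    Disjoint (above v) (above v') := by
  have h1 : ¬ v < v' := fun hlt => lt_irrefl v (h.symm ▸ hlt : v ∈ Iio v)
  have h2 : ¬ v' < v := fun hlt => lt_irrefl v' (h ▸ hlt : v' ∈ Iio v')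
  have h3 : ∀ w, v ≤ w → ¬ v' ≤ w := by
    intro w hv hv'
    rcases IsOrderTree.le_or_le_of_le hv hv' with h | h
    · exact h1 (lt_of_le_of_ne h hne)
    · exact h2 (lt_of_le_of_ne h hne.symm)
  rw [Set.disjoint_left]
  intro q hq hq'
  cases q with
  | node w => exact h3 w hq hq'
  | edge a b hab t =>
    rcases hq with hq | ⟨rfl, -⟩ <;> rcases hq' with hq' | ⟨hb, -⟩
    · exact h3 a hq hq'
    · exact h1 (hb ▸ lt_of_le_of_lt hq hab.lt)
    · exact h2 (lt_of_le_of_lt hq' hab.lt)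
    · exact hne hb

/-- The continuous functions `progress w` separate all but two kinds of pairs: points at the same
position on two roads with a common start, separated by the open roads, and nodes with the same
predecessors. The latter are not at limit levels, because the tree is Hausdorff, and are separated
by the sets `above`. -/
instance [IsHausdorffTree T] : T2Space (RoadSpace T) := by
  refine ⟨fun p q hpq => ?_⟩
  by_cases hex : ∃ w, progress w p ≠ progress w q
  · obtain ⟨w, hw⟩ := hex
    obtain ⟨U, V, hU, hV, hpU, hqV, hUV⟩ := t2_separation hw
    exact ⟨_, _, hU.preimage (continuous_progress w), hV.preimage (continuous_progress w),
      hpU, hqV, hUV.preimage _⟩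
  push Not at hex
  cases p with
  | edge a b h t =>
    cases q with
    | node v => exact absurd ((hex a).symm.trans (progress_edge_self a b h t)) (progress_node_ne t)
    | edge a' b' h' t' =>
      obtain ⟨rfl, rfl⟩ := progress_edge_eq ((hex a).symm.trans (progress_edge_self a b h t))
      refine ⟨_, _, isOpen_of_isBasicOpen (IsBasicOpen.interval h 0 1 le_rfl le_rfl),
        isOpen_of_isBasicOpen (IsBasicOpen.interval h' 0 1 le_rfl le_rfl),
        ⟨t', t'.2, road_of_mem h _⟩, ⟨t', t'.2, road_of_mem h' t'⟩, ?_⟩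
      rw [Set.disjoint_left]
      rintro _ ⟨r, hr, rfl⟩ ⟨s, hs, heq⟩
      rw [road_of_mem h ⟨r, hr⟩, road_of_mem h' ⟨s, hs⟩] at heq
      cases heq
      exact hpq rfl
  | node v =>
    cases q with
    | edge a b h t => exact absurd ((hex a).trans (progress_edge_self a b h t)) (progress_node_ne t)
    | node v' =>
      have hne : v ≠ v' := fun h => hpq (h ▸ rfl)
      have hIio : Iio v = Iio v' := by
        ext w
        have := hex w
        by_cases h1 : w < v <;> by_cases h2 : w < v' <;> simp [progress, h1, h2] at this ⊢
      have hnl : ¬ Order.IsSuccLimit v := fun hv =>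
        hne (IsHausdorffTree.eq_of_Iio_eq v v' hv
          (IsOrderTree.isSuccLimit_of_Iio_eq hIio.symm hv) hIio)
      have hnl' : ¬ Order.IsSuccLimit v' := fun hv =>
        hnl (IsOrderTree.isSuccLimit_of_Iio_eq hIio hv)
      exact ⟨_, _, isOpen_above hnl, isOpen_above hnl', le_rfl (a := v), le_rfl (a := v'),
        disjoint_above hne hIio⟩

/-- On `{q | base q ≤ base c}` only the countably many functions `progress w` with `w ≤ base c` are
needed. They miss exactly the pairs at equal positions on different roads with a common start, and
`Forked m` handles all these roads at once, even if a node has uncountably many successors. -/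
theorem locallySeparated (hT : ∀ x : T, (Iic x).Countable) : LocallySeparated (RoadSpace T) := by
  intro c
  have hU : IsOpen {q : RoadSpace T | base q ≤ base c} :=
    isOpen_iff_mem_nhds.2 fun p hp => eventually_base_le (base c) p hp
  refine ⟨_, hU, le_rfl (a := base c), (image2 (fun w (m : ℕ) p q =>
      1 / ((m : ℝ) + 1) ≤ |progress w p - progress w q|) (Iic (base c)) univ) ∪ range Forked,
    ((hT _).image2 countable_univ _).union (countable_range _), ?_, ?_⟩
  · rintro _ (⟨w, hw, m, -, rfl⟩ | ⟨m, rfl⟩) p -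
    · refine ⟨progress w ⁻¹' Metric.ball (progress w p) (1 / ((m : ℝ) + 1) / 2),
        (continuous_progress w).continuousAt
          (Metric.ball_mem_nhds _ (half_pos Nat.one_div_pos_of_nat)), ?_⟩
      intro a ha b hb hab
      rw [mem_preimage, Metric.mem_ball] at ha hb
      have := dist_triangle_right (progress w a) (progress w b) (progress w p)
      rw [Real.dist_eq] at this
      linarith
    · exact exists_not_forked m p
  · intro p hp q hq hpq
    by_cases hex : ∃ w ≤ base c, progress w p ≠ progress w q
    · obtain ⟨w, hw, hne⟩ := hex
      obtain ⟨m, hm⟩ := exists_nat_one_div_lt (abs_pos.2 (sub_ne_zero.2 hne))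
      exact ⟨_, Or.inl ⟨w, hw, m, mem_univ _, rfl⟩, hm.le⟩
    push Not at hex
    cases p with
    | edge a b h t =>
      cases q with
      | node v =>
        exact absurd ((hex a hp).symm.trans (progress_edge_self a b h t)) (progress_node_ne t)
      | edge a' b' h' t' =>
        obtain ⟨rfl, rfl⟩ := progress_edge_eq ((hex a hp).symm.trans (progress_edge_self a b h t))
        obtain ⟨m, hm⟩ := exists_nat_one_div_lt t'.2.1
        exact ⟨_, Or.inr ⟨m, rfl⟩, _, b, b', h, h', t', t', rfl, rfl,
          fun hb => hpq (by subst hb; rfl), hm.le, hm.le⟩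
    | node v =>
      cases q with
      | edge a b h t => exact absurd ((hex a hq).trans (progress_edge_self a b h t)) (progress_node_ne t)
      | node v' =>
        have hne : v ≠ v' := fun h => hpq (h ▸ rfl)
        exfalso
        -- Both nodes lie below `base c`, so they are comparable, and the progress function of the
        -- lower one is 0 there and 1 at the other.
        rcases IsOrderTree.le_or_le_of_le hp hq with h | h
        · have := hex v hp
          have hlt : v < v' := lt_of_le_of_ne h hne
          simp [progress, hlt] at this
        · have := hex v' hq
          have hlt : v' < v := lt_of_le_of_ne h hne.symm
          simp [progress, hlt] at this

end

end RoadSpace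

theorem theorem6p2 {T : Type u} [PartialOrder T] [TopologicalSpace T] [IsOrderTree T]
    [IsHausdorffTree T] [IsTreeTopology T] :
    (∀ S : Set T, ¬ S.Countable → OmegaOneCompact S →
      ∀ (X : Type v) [TopologicalSpace X] [T2Space X], LocallyMetrizable X →
        (¬ ∃ h : S × unitInterval → X, Continuous h ∧
            (∃ c : X, ∀ s : S, h (s, 0) = c) ∧
            ¬ (range fun s : S => h (s, 1)).Countable) ∧
        ((∃ f : S → X, IsEmbedding f) → ¬ ContractibleSpace X)) ∧
    (treeHeight T = ω₁ → (∃ S : Set T, ¬ S.Countable ∧ OmegaOneCompact S) →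
      ¬ ContractibleSpace (RoadSpace T)) ∧
    (IsSuslinTree T → ¬ ContractibleSpace (RoadSpace T)) := by
  have hunc : ∀ S : Set T, ¬ S.Countable → Uncountable S := fun S hS =>
    not_countable_iff.1 fun h => hS (countable_coe_iff.1 h)
  refine ⟨fun S hS hSc X _ _ hX => ?_, ?_, ?_⟩
  · have := TreeLike.treeLike_subtype S
    refine ⟨?_, ?_⟩
    · rintro ⟨h, hh, ⟨c, hc⟩, hn⟩
      exact hn (TreeLike.countable_range_of_homotopy hSc hX.locallySeparated hh hc)
    · rintro ⟨f, hf⟩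
      exact TreeLike.not_contractibleSpace hSc hX.locallySeparated (hunc S hS) hf.continuous
        hf.injective
  · rintro hT ⟨S, hS, hSc⟩
    have := TreeLike.treeLike_subtype S
    exact TreeLike.not_contractibleSpace hSc
      (RoadSpace.locallySeparated (countable_Iic_of_treeHeight hT)) (hunc S hS)
      (RoadSpace.continuous_node.comp continuous_subtype_val)
      fun a b h => Subtype.ext (RoadSpace.node.inj h)
  · intro hT
    exact TreeLike.not_contractibleSpace
      (IsOrderTree.omegaOneCompact_of_countable_antichains hT.countable_of_isAntichain)
      (RoadSpace.locallySeparated (countable_Iic_of_treeHeight hT.height_eq))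
      (uncountable_of_treeHeight hT.height_eq) RoadSpace.continuous_node
      fun a b h => RoadSpace.node.inj h
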